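/- Let $n\ge 1$ and let $S_n$ be the group of permutations $w=w_1w_2\cdots w_n$ of $[n]=\{1,\dots,n\}$, with Coxeter length $\ell$ (the least number of simple transpositions $(i\ i{+}1)$ whose product is $w$). The (unweighted) quantum Bruhat graph $\Gamma_n$ is the directed graph on $S_n$ with an edge $w\to wt_{ij}$, where $t_{ij}=(i\ j)$ and $1\le i<j\le n$, whenever $\ell(wt_{ij})=\ell(w)+1$ or $\ell(wt_{ij})=\ell(w)+1-2(j-i)$. For $u,v\in S_n$ let $\ell(u,v)$ be the length (number of edges) of a shortest directed path from $u$ to $v$ in $\Gamma_n$. The tilted Bruhat order is defined by: $w\le_u v$ if $\ell(u,w)+\ell(w,v)=\ell(u,v)$, i.e. $w$ lies on a shortest directed path from $u$ to $v$. Put $[u,v]=\{x\in S_n : u\le_u x\le_u v\}$ and $w[k]=\{w_1,\dots,w_k\}$. For $r\in[n]$ let $\le_r$ be the shifted linear order $r<_r r+1<_r\cdots<_r n<_r 1<_r\cdots<_r r-1$ on $[n]$; for subsets $A=\{a_1<_r\cdots<_r a_k\}$ and $B=\{b_1<_r\cdots<_r b_k\}$ of $[n]$ write $A\le_r B$ (shifted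 Gale order) if $a_i\le_r b_i$ for all $i\in[k]$. Theorem. For $u,v,w\in S_n$, the following are equivalent: 1. $w\le_u v$; 2. $w\in[u,v]$; 3. for every sequence $a_1,\dots,a_{n-1}\in[n]$ such that $u[k]\le_{a_k}v[k]$ for all $k\in[n-1]$, we have $u[k]\le_{a_k}w[k]\le_{a_k}v[k]$ for all $k\in[n-1]$; 4. there exists a sequence $a_1,\dots,a_{n-1}\in[n]$ such that $u[k]\le_{a_k}w[k]\le_{a_k}v[k]$ for all $k\in[n-1]$. -/

import Mathlib

namespace TiltedBruhat

/-! Permutations of `{1, …, n}` are `Equiv.Perm (Fin n)`: positions and values are numbered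
`0, …, n - 1`.  The one-line notation of `w` is `w 0, w 1, …, w (n - 1)`. -/

/-- `s` is a simple transposition `(i i+1)`. -/
def IsSimple {n : ℕ} (s : Equiv.Perm (Fin n)) : Prop :=
  ∃ i j : Fin n, (i : ℕ) + 1 = j ∧ s = Equiv.swap i j

/-- Coxeter length: the least number of simple transpositions whose product is `w`. -/
noncomputable def coxeterLength {n : ℕ} (w : Equiv.Perm (Fin n)) : ℕ :=
  sInf {m | ∃ l : List (Equiv.Perm (Fin n)), (∀ s ∈ l, IsSimple s) ∧ l.prod = w ∧ l.length = m}

/-- The (unweighted) quantum Bruhat graph on `S_n`.  There is an edge `w → w t_{ij}`, `i < j`, if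
`ℓ(w t_{ij}) = ℓ(w) + 1` or `ℓ(w t_{ij}) = ℓ(w) + 1 - 2(j - i)`; the multiplication on the right by
`t_{ij}` exchanges the entries at the positions `i` and `j`. -/
def quantumBruhatGraph (n : ℕ) : Digraph (Equiv.Perm (Fin n)) where
  Adj w w' := ∃ i j : Fin n, i < j ∧ w' = w * Equiv.swap i j ∧
    ((coxeterLength w' : ℤ) = coxeterLength w + 1 ∨
      (coxeterLength w' : ℤ) = coxeterLength w + 1 - 2 * (((j : ℕ) : ℤ) - ((i : ℕ) : ℤ)))

/-- There is a directed path `u = p 0 → p 1 → ⋯ → p m = v` of length `m`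
in the quantum Bruhat graph. -/
def HasPath {n : ℕ} (u v : Equiv.Perm (Fin n)) (m : ℕ) : Prop :=
  ∃ p : ℕ → Equiv.Perm (Fin n), p 0 = u ∧ p m = v ∧
    ∀ i < m, (quantumBruhatGraph n).Adj (p i) (p (i + 1))

/-- `ℓ(u, v)`: the length of a shortest directed path from `u` to `v`.  (Some path always exists,
see `exists_hasPath` below.) -/
noncomputable def pathDist {n : ℕ} (u v : Equiv.Perm (Fin n)) : ℕ :=
  sInf {m | HasPath u v m}

/-- The tilted Bruhat order `w ≤_u v`. -/
def TiltedLE {n : ℕ} (u w v : Equiv.Perm (Fin n)) : Prop :=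
  pathDist u w + pathDist w v = pathDist u v

/-- The tilted Bruhat interval `[u, v] = {x | u ≤_u x ≤_u v}`. -/
def tiltedInterval {n : ℕ} (u v : Equiv.Perm (Fin n)) : Set (Equiv.Perm (Fin n)) :=
  {x | TiltedLE u u x ∧ TiltedLE u x v}

/-- `w[k] = {w_1, …, w_k}`: the set of the first `k` entries of `w`. -/
def initialSet {n : ℕ} (w : Equiv.Perm (Fin n)) (k : ℕ) : Finset (Fin n) :=
  (Finset.univ.filter fun i : Fin n => (i : ℕ) < k).image w

/-- The shifted linear order `r <_r r+1 <_r ⋯ <_r n <_r 1 <_r ⋯ <_r r-1`: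
`x ≤_r y` if `(x - r) mod n ≤ (y - r) mod n` (subtraction in `Fin n` is modulo `n`). -/
def ShiftedLE {n : ℕ} (r x y : Fin n) : Prop := x - r ≤ y - r

/-- The strict form of the shifted linear order. -/
def ShiftedLT {n : ℕ} (r x y : Fin n) : Prop := x - r < y - r

/-- The shifted Gale order: `A = {α_1 <_r ⋯ <_r α_k}`, `B = {β_1 <_r ⋯ <_r β_k}`
and `α_i ≤_r β_i` for all `i`. -/
def GaleLE {n : ℕ} (r : Fin n) (A B : Finset (Fin n)) : Prop :=
  ∃ (k : ℕ) (α β : Fin k → Fin n),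
    (∀ i j, i < j → ShiftedLT r (α i) (α j)) ∧ (∀ i j, i < j → ShiftedLT r (β i) (β j)) ∧
    Finset.univ.image α = A ∧ Finset.univ.image β = B ∧ ∀ i, ShiftedLE r (α i) (β i)

/-! The quantum Bruhat graph is strongly connected, and the Coxeter length is the number of
inversions. -/

/-- The inversion set of `w`. -/
def inversions {n : ℕ} (w : Equiv.Perm (Fin n)) : Finset (Fin n × Fin n) :=
  Finset.univ.filter fun p => p.1 < p.2 ∧ w p.2 < w p.1

theorem mem_inversions {n : ℕ} (w : Equiv.Perm (Fin n)) (a b : Fin n) :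
    (a, b) ∈ inversions w ↔ a < b ∧ w b < w a := by
  simp [inversions]

theorem swap_lt_swap {n : ℕ} {i j : Fin n} (h : (i : ℕ) + 1 = j) {a b : Fin n} (hab : a < b)
    (hne : ¬(a = i ∧ b = j)) : Equiv.swap i j a < Equiv.swap i j b := by
  simp only [Equiv.swap_apply_def]
  split_ifs <;> simp only [Fin.lt_def, Fin.ext_iff] at * <;> omega

theorem card_inversions_mul {n : ℕ} (w : Equiv.Perm (Fin n)) {i j : Fin n}
    (h : (i : ℕ) + 1 = j) (hw : w i < w j) :
    (inversions (w * Equiv.swap i j)).card = (inversions w).card + 1 := by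
  have hij : i < j := by rw [Fin.lt_def]; omega
  have key : inversions (w * Equiv.swap i j) = insert (i, j)
      ((inversions w).map ((Equiv.swap i j).prodCongr (Equiv.swap i j)).toEmbedding) := by
    ext ⟨a, b⟩
    rw [Finset.mem_insert, Finset.mem_map_equiv]
    simp only [mem_inversions, Equiv.Perm.mul_apply,
      Equiv.prodCongr_symm, Equiv.symm_swap, Equiv.prodCongr_apply, Prod.map, Prod.mk.injEq]
    by_cases hne : a = i ∧ b = j
    · simp [hne.1, hne.2, hij, hw]
    · simp only [hne, false_or]
      refine and_congr_left fun hlt => ⟨fun hab => swap_lt_swap h hab hne, fun hab => ?_⟩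
      have hne' : ¬(Equiv.swap i j a = i ∧ Equiv.swap i j b = j) := by
        rintro ⟨h1, h2⟩
        rw [h1, h2] at hlt
        exact lt_asymm hlt hw
      simpa using swap_lt_swap h hab hne'
  rw [key, Finset.card_insert_of_notMem, Finset.card_map]
  rw [Finset.mem_map_equiv]
  simp only [mem_inversions, Equiv.prodCongr_symm,
    Equiv.symm_swap, Equiv.prodCongr_apply, Prod.map, Equiv.swap_apply_left,
    Equiv.swap_apply_right]
  exact fun hh => lt_asymm hh.1 hij

theorem card_inversions_mul' {n : ℕ} (w : Equiv.Perm (Fin n)) {i j : Fin n}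
    (h : (i : ℕ) + 1 = j) (hw : w j < w i) :
    (inversions (w * Equiv.swap i j)).card + 1 = (inversions w).card := by
  have := card_inversions_mul (w * Equiv.swap i j) h (by simpa using hw)
  rw [mul_assoc, Equiv.swap_mul_self, mul_one] at this
  exact this.symm

theorem exists_descent {n : ℕ} (w : Equiv.Perm (Fin n)) (hw : w ≠ 1) :
    ∃ i j : Fin n, (i : ℕ) + 1 = j ∧ w j < w i := by
  by_contra! hc
  apply hw
  cases n with
  | zero => exact Subsingleton.elim _ _
  | succ n =>
    have hm : StrictMono w := Fin.strictMono_iff_lt_succ.2 fun i =>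
      lt_of_le_of_ne (hc i.castSucc i.succ (by simp)) fun he => by
        simpa [Fin.ext_iff] using w.injective he
    have h1 : (hm.orderIsoOfSurjective w w.surjective) = OrderIso.refl _ :=
      Subsingleton.elim _ _
    ext i
    simpa using congrArg (fun f : Fin (n + 1) ≃o Fin (n + 1) => ((f i : Fin (n + 1)) : ℕ)) h1

theorem inversions_one (n : ℕ) : inversions (1 : Equiv.Perm (Fin n)) = ∅ := by
  rw [Finset.eq_empty_iff_forall_notMem]
  rintro ⟨a, b⟩ h
  rw [mem_inversions] at h
  exact lt_asymm h.1 h.2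

theorem exists_word {n : ℕ} (w : Equiv.Perm (Fin n)) :
    ∃ l : List (Equiv.Perm (Fin n)), (∀ s ∈ l, IsSimple s) ∧ l.prod = w ∧
      l.length = (inversions w).card := by
  induction hm : (inversions w).card generalizing w with
  | zero =>
    by_cases hw : w = 1
    · exact ⟨[], by simp, by simp [hw], rfl⟩
    · obtain ⟨i, j, h, hlt⟩ := exists_descent w hw
      have := card_inversions_mul' w h hlt
      omega
  | succ m ih =>
    have hw : w ≠ 1 := by
      rintro rfl
      simp [inversions_one] at hm
    obtain ⟨i, j, h, hlt⟩ := exists_descent w hw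
    have := card_inversions_mul' w h hlt
    obtain ⟨l, hl, hp, hc⟩ := ih (w * Equiv.swap i j) (by omega)
    refine ⟨l ++ [Equiv.swap i j], ?_, ?_, by simp [hc]⟩
    · intro s hs
      rcases List.mem_append.1 hs with hs | hs
      · exact hl s hs
      · exact ⟨i, j, h, by simpa using hs⟩
    · simp [hp, mul_assoc]

theorem card_inversions_le {n : ℕ} (l : List (Equiv.Perm (Fin n))) (hl : ∀ s ∈ l, IsSimple s) :
    (inversions l.prod).card ≤ l.length := by
  induction l using List.reverseRecOn with
  | nil => simp [inversions_one]
  | append_singleton l s ih =>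
    have h1 := ih fun t ht => hl t (by simp [ht])
    obtain ⟨i, j, h, rfl⟩ := hl s (by simp)
    have hij : i ≠ j := by
      rintro rfl
      omega
    simp only [List.prod_append, List.prod_singleton, List.length_append, List.length_singleton]
    rcases lt_or_gt_of_ne (l.prod.injective.ne hij) with hlt | hlt
    · have := card_inversions_mul l.prod h hlt
      omega
    · have := card_inversions_mul' l.prod h hlt
      omega

theorem coxeterLength_eq_card_inversions {n : ℕ} (w : Equiv.Perm (Fin n)) :
    coxeterLength w = (inversions w).card := by
  apply le_antisymm
  · exact Nat.sInf_le (exists_word w)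
  · obtain ⟨l, hl, rfl, hm⟩ := Nat.sInf_mem (⟨_, exists_word w⟩ : Set.Nonempty
      {m | ∃ l : List (Equiv.Perm (Fin n)), (∀ s ∈ l, IsSimple s) ∧ l.prod = w ∧ l.length = m})
    exact (card_inversions_le l hl).trans hm.le

theorem adj_mul_simple {n : ℕ} (w s : Equiv.Perm (Fin n)) (hs : IsSimple s) :
    (quantumBruhatGraph n).Adj w (w * s) := by
  obtain ⟨i, j, h, rfl⟩ := hs
  have hij : i < j := by rw [Fin.lt_def]; omega
  refine ⟨i, j, hij, rfl, ?_⟩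
  rw [coxeterLength_eq_card_inversions, coxeterLength_eq_card_inversions]
  rcases lt_or_gt_of_ne (w.injective.ne hij.ne) with hlt | hlt
  · have := card_inversions_mul w h hlt
    left
    omega
  · have := card_inversions_mul' w h hlt
    right
    omega

/-- Any two permutations are joined by a directed path in the quantum Bruhat graph. -/
theorem exists_hasPath {n : ℕ} (u v : Equiv.Perm (Fin n)) : ∃ m, HasPath u v m := by
  obtain ⟨l, hl, hp, -⟩ := exists_word (u⁻¹ * v)
  refine ⟨l.length, fun i => u * (l.take i).prod, by simp, by simp [hp], fun i hi => ?_⟩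
  have h2 : u * (l.take (i + 1)).prod = u * (l.take i).prod * l[i] := by
    rw [List.prod_take_succ l i hi, mul_assoc]
  beta_reduce
  rw [h2]
  exact adj_mul_simple _ _ (hl _ (List.getElem_mem hi))

end TiltedBruhat

open TiltedBruhat

/-!
For sets `A`, `B` of the same size let `excess A B r = #{x ∈ B | x < r} - #{x ∈ A | x < r}`, and let
`depth A B` be its maximum over all cuts `r`. Counting in the order `≤_r` shows that `A ≤_r B` in
the shifted Gale order if and only if the cut `r` attains this maximum
(`galeLE_iff_excess_eq_depth`).

The distance in the quantum Bruhat graph is then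
`ℓ(u, v) = ℓ(v) - ℓ(u) + 2 ∑ m, depth (u[m]) (v[m])` (`pathDist_eq_tiltedLength`).

* The right-hand side satisfies the triangle inequality, because the maximum of a sum is at most the
  sum of the maxima, and it is at most `1` on an edge (`tiltedLength_le_one_of_adj`). So every path
  is at least that long.
* If `u ≠ v`, let `i` be the first position where they differ, and let `j > i` be the first later
  position with `u j` in the cyclic interval `(u i, v i]`. Exchanging the entries at `i` and `j`
  follows an edge, of ordinary or quantum type according to whether `u i < u j` or `u j < u i`. No
  cut in `(u i, v i]` attains the depth of `u[m], v[m]` for `i < m ≤ j`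
  (`excess_lt_depth_of_arc`), which makes the right-hand side drop by one
  (`exists_adj_tiltedLength_lt`).

Hence `w ≤_u v` if and only if, for each `m`, the maximum of the sum
`excess u[m] v[m] = excess u[m] w[m] + excess w[m] v[m]` equals the sum of the two maxima. This holds
if some cut maximizes both summands, and if it holds then every cut that maximizes the sum maximizes
both summands. In terms of the Gale order these are the last two conditions of the theorem.
-/

namespace TiltedBruhat

/-! ### Depth of a pair of subsets -/

/-- The number of elements of `A` below the cut `r`, that is, with value less than `r`.
Cuts are natural numbers, so that `r = n` (all of `A`) is allowed. -/
def countBelow {n : ℕ} (A : Finset (Fin n)) (r : ℕ) : ℕ :=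
  (A.filter fun x : Fin n => (x : ℕ) < r).card

/-- The surplus of `B` over `A` below the cut `r`. -/
def excess {n : ℕ} (A B : Finset (Fin n)) (r : ℕ) : ℤ := countBelow B r - countBelow A r

/-- The largest excess of `B` over `A` over all the cuts `0, …, n`. The subtraction of natural
numbers truncates, which is harmless because the excess at the cut `0` is `0`. -/
def depth {n : ℕ} (A B : Finset (Fin n)) : ℕ :=
  (Finset.range (n + 1)).sup fun r => countBelow B r - countBelow A r

theorem countBelow_zero {n : ℕ} (A : Finset (Fin n)) : countBelow A 0 = 0 := by
  simp [countBelow]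

theorem countBelow_self {n : ℕ} (A : Finset (Fin n)) : countBelow A n = A.card := by
  simp [countBelow]

theorem excess_zero {n : ℕ} (A B : Finset (Fin n)) : excess A B 0 = 0 := by
  simp [excess, countBelow_zero]

theorem excess_self {n : ℕ} {A B : Finset (Fin n)} (h : A.card = B.card) : excess A B n = 0 := by
  simp [excess, countBelow_self, h]

theorem excess_add {n : ℕ} (A B C : Finset (Fin n)) (r : ℕ) :
    excess A B r + excess B C r = excess A C r := by
  simp only [excess]; ring

theorem depth_le_iff {n : ℕ} {A B : Finset (Fin n)} {d : ℕ} :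
    depth A B ≤ d ↔ ∀ r ≤ n, excess A B r ≤ d := by
  simp only [depth, Finset.sup_le_iff, Finset.mem_range, excess, Nat.lt_succ_iff]
  refine forall₂_congr fun r _ => ?_
  omega

theorem excess_le_depth {n : ℕ} (A B : Finset (Fin n)) {r : ℕ} (hr : r ≤ n) :
    excess A B r ≤ depth A B :=
  depth_le_iff.1 le_rfl r hr

theorem depth_triangle {n : ℕ} (A B C : Finset (Fin n)) :
    depth A C ≤ depth A B + depth B C := by
  refine depth_le_iff.2 fun r hr => ?_
  have h1 := excess_le_depth A B hr
  have h2 := excess_le_depth B C hr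
  have h3 := excess_add A B C r
  push_cast
  omega

theorem depth_self {n : ℕ} (A : Finset (Fin n)) : depth A A = 0 := by
  simp [depth]

theorem excess_eq_depth_iff {n : ℕ} {A B : Finset (Fin n)} (h : A.card = B.card) (r : Fin n) :
    excess A B r = depth A B ↔ ∀ s : Fin n, excess A B s ≤ excess A B r := by
  refine ⟨fun hr s => hr ▸ excess_le_depth A B s.2.le, fun hr => ?_⟩
  refine le_antisymm (excess_le_depth A B r.2.le) ?_
  have h0 : 0 ≤ excess A B r := by
    simpa [excess_zero] using hr ⟨0, r.pos⟩
  have : depth A B ≤ (excess A B r).toNat := by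
    refine depth_le_iff.2 fun s hs => ?_
    rw [Int.toNat_of_nonneg h0]
    rcases hs.eq_or_lt with rfl | hs
    · rwa [excess_self h]
    · exact hr ⟨s, hs⟩
  omega

theorem exists_excess_eq_depth {n : ℕ} [NeZero n] {A B : Finset (Fin n)} (h : A.card = B.card) :
    ∃ r : Fin n, excess A B r = depth A B := by
  obtain ⟨r, hr⟩ := Finite.exists_max fun r : Fin n => excess A B r
  exact ⟨r, (excess_eq_depth_iff h r).2 hr⟩

/-! ### The shifted Gale order in terms of depth -/

instance {n : ℕ} (r x y : Fin n) : Decidable (ShiftedLT r x y) :=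
  inferInstanceAs (Decidable (x - r < y - r))

/-- Counting in the shifted order from `r` differs from counting in the usual order by a quantity
that depends on `A` only through `countBelow A r` and `A.card`. -/
theorem card_shiftedLT {n : ℕ} (A : Finset (Fin n)) (r s : Fin n) :
    ((A.filter fun x => ShiftedLT r x s).card : ℤ) =
      countBelow A s - countBelow A r + if s < r then (A.card : ℤ) else 0 := by
  have hpt : ∀ x : Fin n, (if ShiftedLT r x s then 1 else 0 : ℤ) =
      (if (x : ℕ) < s then 1 else 0) - (if (x : ℕ) < r then 1 else 0) +
        if s < r then 1 else 0 := by
    intro x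
    have hx : ShiftedLT r x s ↔ (if r ≤ x then (x : ℕ) - r else n + x - r) <
        (if r ≤ s then (s : ℕ) - r else n + s - r) := by
      unfold ShiftedLT
      rw [Fin.lt_def]
      split_ifs with h1 h2 h2
      · rw [Fin.sub_val_of_le h1, Fin.sub_val_of_le h2]
      · rw [Fin.sub_val_of_le h1, Fin.coe_sub_iff_lt.2 (not_le.1 h2)]
      · rw [Fin.sub_val_of_le h2, Fin.coe_sub_iff_lt.2 (not_le.1 h1)]
      · rw [Fin.coe_sub_iff_lt.2 (not_le.1 h2), Fin.coe_sub_iff_lt.2 (not_le.1 h1)]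
    rw [if_congr hx rfl rfl]
    have := x.2
    have := s.2
    have := r.2
    simp only [Fin.le_def, Fin.lt_def]
    split_ifs <;> omega
  simp only [countBelow, Finset.card_filter, Finset.card_eq_sum_ones A, Nat.cast_sum, Nat.cast_ite,
    Nat.cast_one, Nat.cast_zero]
  rw [Finset.sum_congr rfl fun x _ => hpt x, Finset.sum_add_distrib, Finset.sum_sub_distrib]
  split_ifs <;> simp

theorem injective_of_shiftedLT {n k : ℕ} {r : Fin n} {γ : Fin k → Fin n}
    (hγ : ∀ i j, i < j → ShiftedLT r (γ i) (γ j)) : Function.Injective γ :=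
  Function.Injective.of_comp (f := fun x => x - r) (StrictMono.injective fun i j h => hγ i j h)

theorem GaleLE.card_eq {n : ℕ} {r : Fin n} {A B : Finset (Fin n)} (h : GaleLE r A B) :
    A.card = B.card := by
  obtain ⟨k, α, β, hα, hβ, rfl, rfl, -⟩ := h
  rw [Finset.card_image_of_injective _ (injective_of_shiftedLT hα),
    Finset.card_image_of_injective _ (injective_of_shiftedLT hβ)]

/-- The increasing enumeration of a set with respect to the shifted order. -/
theorem exists_shifted_enum {n k : ℕ} (r : Fin n) {A : Finset (Fin n)} (h : A.card = k) :
    ∃ α : Fin k → Fin n, (∀ i j, i < j → ShiftedLT r (α i) (α j)) ∧ Finset.univ.image α = A := by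
  have : NeZero n := ⟨r.pos.ne'⟩
  have hc : (A.image fun x => x - r).card = k := by
    rw [Finset.card_image_of_injective _ (sub_left_injective), h]
  refine ⟨fun i => (A.image fun x => x - r).orderEmbOfFin hc i + r, fun i j hij => ?_, ?_⟩
  · simpa [ShiftedLT] using hij
  · ext x
    have := Set.ext_iff.1 (Finset.range_orderEmbOfFin (A.image fun x => x - r) hc) (x - r)
    rw [Set.mem_range, Finset.mem_coe,
      Function.Injective.mem_finset_image (sub_left_injective (b := r))] at this
    simpa only [Finset.mem_image, Finset.mem_univ, true_and, ← eq_sub_iff_add_eq] using this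

theorem galeLE_iff_card_filter {n : ℕ} (r : Fin n) {A B : Finset (Fin n)} (h : A.card = B.card) :
    GaleLE r A B ↔ ∀ s : Fin n, (B.filter fun x => ShiftedLT r x s).card ≤
      (A.filter fun x => ShiftedLT r x s).card := by
  have cnt : ∀ {k : ℕ} (γ : Fin k → Fin n), (∀ i j, i < j → ShiftedLT r (γ i) (γ j)) →
      ∀ s, ((Finset.univ.image γ).filter fun x => ShiftedLT r x s).card =
        (Finset.univ.filter fun i => ShiftedLT r (γ i) s).card := fun γ hγ s => by
    rw [Finset.filter_image, Finset.card_image_of_injective _ (injective_of_shiftedLT hγ)]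
  constructor
  · rintro ⟨k, α, β, hα, hβ, rfl, rfl, hle⟩ s
    rw [cnt α hα, cnt β hβ]
    refine Finset.card_le_card fun i hi => ?_
    rw [Finset.mem_filter] at hi ⊢
    exact ⟨hi.1, (hle i).trans_lt hi.2⟩
  · intro hcard
    obtain ⟨k, hk⟩ : ∃ k, B.card = k := ⟨_, rfl⟩
    obtain ⟨α, hα, hA⟩ := exists_shifted_enum r (h.trans hk)
    obtain ⟨β, hβ, hB⟩ := exists_shifted_enum r hk
    refine ⟨_, α, β, hα, hβ, hA, hB, fun i => ?_⟩
    by_contra hlt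
    have hlt : ShiftedLT r (β i) (α i) := not_le.1 hlt
    -- Below `α i` there are exactly `i` elements of `A` but at least `i + 1` elements of `B`.
    have h1 := hcard (α i)
    have hs1 : (Finset.univ.filter fun j => ShiftedLT r (α j) (α i)) ⊆ Finset.Iio i := by
      intro j hj
      rw [Finset.mem_filter] at hj
      rw [Finset.mem_Iio]
      by_contra hji
      rcases (not_lt.1 hji).eq_or_lt with rfl | hij
      · exact lt_irrefl _ hj.2
      · exact lt_asymm hj.2 (hα i j hij)
    have hs2 : Finset.Iic i ⊆ (Finset.univ.filter fun j => ShiftedLT r (β j) (α i)) := by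
      intro j hj
      rw [Finset.mem_Iic] at hj
      rw [Finset.mem_filter]
      refine ⟨Finset.mem_univ _, ?_⟩
      rcases hj.eq_or_lt with rfl | hij
      · exact hlt
      · exact lt_trans (hβ j i hij) hlt
    rw [← hA, ← hB, cnt α hα, cnt β hβ] at h1
    have h2 := Finset.card_le_card hs1
    have h3 := Finset.card_le_card hs2
    rw [Fin.card_Iio] at h2
    rw [Fin.card_Iic] at h3
    omega

/-- `A ≤_r B` in the shifted Gale order exactly when the cut at `r` realizes the depth. -/
theorem galeLE_iff_excess_eq_depth {n : ℕ} (r : Fin n) {A B : Finset (Fin n)}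
    (h : A.card = B.card) : GaleLE r A B ↔ excess A B r = depth A B := by
  rw [galeLE_iff_card_filter r h, excess_eq_depth_iff h]
  refine forall_congr' fun s => ?_
  have h1 := card_shiftedLT A r s
  have h2 := card_shiftedLT B r s
  rw [h] at h1
  simp only [excess]
  omega

/-! ### Inversions and initial sets under a transposition -/

theorem card_inversions_eq_sum {n : ℕ} (w : Equiv.Perm (Fin n)) :
    ((inversions w).card : ℤ) = ∑ a, ∑ b, if a < b ∧ w b < w a then 1 else 0 := by
  rw [inversions, Finset.card_filter, Fintype.sum_prod_type]
  push_cast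
  rfl

/-- Multiplication by `t_{ij}` with `w i < w j` adds one inversion, and two more for each position
between `i` and `j` whose entry lies between `w i` and `w j`. -/
theorem card_inversions_mul_swap {n : ℕ} (w : Equiv.Perm (Fin n)) {i j : Fin n} (hij : i < j)
    (hw : w i < w j) :
    (inversions (w * Equiv.swap i j)).card = (inversions w).card + 1 +
      2 * ((Finset.Ioo i j).filter fun m => w i < w m ∧ w m < w j).card := by
  have hpt : ∀ a b : Fin n,
      (if Equiv.swap i j a < Equiv.swap i j b ∧ w b < w a then 1 else 0 : ℤ) =
      (if a < b ∧ w b < w a then 1 else 0)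
      + (if a = j then if b = i then 1 else 0 else 0)
      + (if a = j then if i < b ∧ b < j ∧ w b < w j then 1 else 0 else 0)
      - (if a = i then if i < b ∧ b < j ∧ w b < w i then 1 else 0 else 0)
      + (if b = i then if i < a ∧ a < j ∧ w i < w a then 1 else 0 else 0)
      - (if b = j then if i < a ∧ a < j ∧ w j < w a then 1 else 0 else 0) := by
    intro a b
    by_cases ha : a = i
    · subst ha
      by_cases hb : b = a
      · subst hb; simp [hij.ne]
      by_cases hb' : b = j
      · subst hb'; simp [hij.ne, hij.ne', hij.not_gt, hw.not_gt]
      · rw [Equiv.swap_apply_left, Equiv.swap_apply_of_ne_of_ne hb hb']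
        simp only [Fin.lt_def, Fin.ext_iff] at *
        split_ifs <;> omega
    by_cases ha' : a = j
    · subst ha'
      by_cases hb : b = i
      · subst hb; simp [hij.ne, hij.ne', hij, hw, hij.not_gt]
      by_cases hb' : b = a
      · subst hb'; simp [hij.ne']
      · rw [Equiv.swap_apply_right, Equiv.swap_apply_of_ne_of_ne hb hb']
        simp only [Fin.lt_def, Fin.ext_iff] at *
        split_ifs <;> omega
    rw [Equiv.swap_apply_of_ne_of_ne ha ha']
    by_cases hb : b = i
    · subst hb
      rw [Equiv.swap_apply_left]
      simp only [Fin.lt_def, Fin.ext_iff] at *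
      split_ifs <;> omega
    by_cases hb' : b = j
    · subst hb'
      rw [Equiv.swap_apply_right]
      simp only [Fin.lt_def, Fin.ext_iff] at *
      split_ifs <;> omega
    · rw [Equiv.swap_apply_of_ne_of_ne hb hb']
      simp [ha, ha', hb, hb']
  have hmid : ∀ m : Fin n, (if i < m ∧ m < j ∧ w m < w j then 1 else 0 : ℤ)
      - (if i < m ∧ m < j ∧ w m < w i then 1 else 0)
      + (if i < m ∧ m < j ∧ w i < w m then 1 else 0)
      - (if i < m ∧ m < j ∧ w j < w m then 1 else 0)
      = 2 * if (i < m ∧ m < j) ∧ (w i < w m ∧ w m < w j) then 1 else 0 := by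
    intro m
    have h1 : m ≠ i → w m ≠ w i := w.injective.ne
    have h2 : m ≠ j → w m ≠ w j := w.injective.ne
    simp only [Fin.lt_def, Fin.ext_iff, ne_eq] at *
    split_ifs <;> omega
  have hcard : (((Finset.Ioo i j).filter fun m => w i < w m ∧ w m < w j).card : ℤ) =
      ∑ m, if (i < m ∧ m < j) ∧ (w i < w m ∧ w m < w j) then 1 else 0 := by
    rw [Finset.sum_boole]
    congr 2
    ext m
    simp
  have key : ((inversions (w * Equiv.swap i j)).card : ℤ) = (inversions w).card + 1 +
      2 * ((Finset.Ioo i j).filter fun m => w i < w m ∧ w m < w j).card := by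
    rw [hcard, Finset.mul_sum, ← Finset.sum_congr rfl fun m _ => hmid m,
      card_inversions_eq_sum w, card_inversions_eq_sum,
      ← Equiv.sum_comp (Equiv.swap i j)]
    rw [Finset.sum_congr rfl fun a _ => (Equiv.sum_comp (Equiv.swap i j) _).symm]
    simp only [Equiv.Perm.mul_apply, Equiv.swap_apply_self, hpt]
    simp only [Finset.sum_add_distrib, Finset.sum_sub_distrib]
    rw [Finset.sum_comm (f := fun a b : Fin n =>
        (if b = i then if i < a ∧ a < j ∧ w i < w a then 1 else 0 else 0 : ℤ)),
      Finset.sum_comm (f := fun a b : Fin n =>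
        (if b = j then if i < a ∧ a < j ∧ w j < w a then 1 else 0 else 0 : ℤ))]
    simp
    ring
  exact_mod_cast key

theorem mul_swap_mul_swap {n : ℕ} (w : Equiv.Perm (Fin n)) (i j : Fin n) :
    w * Equiv.swap i j * Equiv.swap i j = w := by
  rw [mul_assoc, Equiv.swap_mul_self, mul_one]

theorem card_initialSet {n : ℕ} (w w' : Equiv.Perm (Fin n)) (m : ℕ) :
    (initialSet w m).card = (initialSet w' m).card := by
  rw [initialSet, initialSet, Finset.card_image_of_injective _ w.injective,
    Finset.card_image_of_injective _ w'.injective]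

theorem countBelow_initialSet {n : ℕ} (w : Equiv.Perm (Fin n)) (m r : ℕ) :
    (countBelow (initialSet w m) r : ℤ) =
      ∑ p : Fin n, if (p : ℕ) < m ∧ (w p : ℕ) < r then 1 else 0 := by
  rw [countBelow, initialSet, Finset.filter_image, Finset.card_image_of_injective _ w.injective,
    Finset.filter_filter, Finset.sum_boole]

/-- Exchanging the entries at positions `i < j` replaces `w i` by `w j` in the initial sets of size
`m` with `i < m ≤ j`, and does not change the others. -/
theorem countBelow_initialSet_mul_swap {n : ℕ} (w : Equiv.Perm (Fin n)) {i j : Fin n}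
    (hij : i < j) (m r : ℕ) :
    (countBelow (initialSet (w * Equiv.swap i j) m) r : ℤ) = countBelow (initialSet w m) r +
      if (i : ℕ) < m ∧ m ≤ j then
        (if (w j : ℕ) < r then 1 else 0) - (if (w i : ℕ) < r then 1 else 0) else 0 := by
  have hpt : ∀ p : Fin n, (if (Equiv.swap i j p : ℕ) < m ∧ (w p : ℕ) < r then 1 else 0 : ℤ) =
      (if (p : ℕ) < m ∧ (w p : ℕ) < r then 1 else 0)
      + (if p = j then if ((i : ℕ) < m ∧ m ≤ j) ∧ (w j : ℕ) < r then 1 else 0 else 0)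
      - (if p = i then if ((i : ℕ) < m ∧ m ≤ j) ∧ (w i : ℕ) < r then 1 else 0 else 0) := by
    intro p
    rw [Fin.lt_def] at hij
    by_cases hi : p = i
    · subst hi
      rw [Equiv.swap_apply_left]
      simp only [Fin.ext_iff]
      split_ifs <;> omega
    by_cases hj : p = j
    · subst hj
      rw [Equiv.swap_apply_right]
      simp only [Fin.ext_iff]
      split_ifs <;> omega
    · rw [Equiv.swap_apply_of_ne_of_ne hi hj]
      simp [hi, hj]
  rw [countBelow_initialSet, countBelow_initialSet, ← Equiv.sum_comp (Equiv.swap i j)]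
  simp only [Equiv.Perm.mul_apply, Equiv.swap_apply_self, hpt]
  simp only [Finset.sum_add_distrib, Finset.sum_sub_distrib, Finset.sum_ite_eq', Finset.mem_univ,
    if_true]
  split_ifs <;> omega

/-! ### The distance in the quantum Bruhat graph -/

/-- The value of the distance from `u` to `v`: the difference of the Coxeter lengths plus twice the
total depth of the pairs of initial sets. -/
noncomputable def tiltedLength {n : ℕ} (u v : Equiv.Perm (Fin n)) : ℤ :=
  coxeterLength v - coxeterLength u +
    2 * ((∑ m ∈ Finset.range n, depth (initialSet u m) (initialSet v m) : ℕ) : ℤ)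

theorem tiltedLength_self {n : ℕ} (u : Equiv.Perm (Fin n)) : tiltedLength u u = 0 := by
  simp [tiltedLength, depth_self]

theorem tiltedLength_triangle {n : ℕ} (u w v : Equiv.Perm (Fin n)) :
    tiltedLength u v ≤ tiltedLength u w + tiltedLength w v := by
  have h : ∑ m ∈ Finset.range n, depth (initialSet u m) (initialSet v m) ≤
      ∑ m ∈ Finset.range n, depth (initialSet u m) (initialSet w m) +
      ∑ m ∈ Finset.range n, depth (initialSet w m) (initialSet v m) := by
    rw [← Finset.sum_add_distrib]
    exact Finset.sum_le_sum fun m _ => depth_triangle _ _ _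
  simp only [tiltedLength]
  omega

theorem sum_range_ite_between {n : ℕ} (i j : Fin n) :
    (∑ m ∈ Finset.range n, if (i : ℕ) < m ∧ m ≤ j then 1 else 0) = (j : ℕ) - i := by
  rw [← Finset.card_filter, ← Nat.card_Ioc]
  congr 1
  ext m
  simp only [Finset.mem_filter, Finset.mem_range, Finset.mem_Ioc]
  have := j.2
  omega

theorem tiltedLength_le_one_of_adj {n : ℕ} {u x : Equiv.Perm (Fin n)}
    (h : (quantumBruhatGraph n).Adj u x) : tiltedLength u x ≤ 1 := by
  obtain ⟨i, j, hij, rfl, h⟩ := h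
  have hexc (m r : ℕ) := countBelow_initialSet_mul_swap u hij m r
  rcases h with h | h
  · have hlt : u i < u j := by
      by_contra hle
      have hlt := lt_of_le_of_ne (not_lt.1 hle) (u.injective.ne hij.ne')
      have := card_inversions_mul_swap (u * Equiv.swap i j) hij (by simpa using hlt)
      rw [mul_swap_mul_swap, ← coxeterLength_eq_card_inversions,
        ← coxeterLength_eq_card_inversions] at this
      omega
    have h0 : ∑ m ∈ Finset.range n,
        depth (initialSet u m) (initialSet (u * Equiv.swap i j) m) = 0 := by
      refine Finset.sum_eq_zero fun m _ => Nat.le_zero.1 (depth_le_iff.2 fun r _ => ?_)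
      have := hexc m r
      rw [Fin.lt_def] at hlt
      rw [excess, this]
      split_ifs <;> omega
    rw [tiltedLength, h0, h]
    simp
  · have h0 : ∑ m ∈ Finset.range n,
        depth (initialSet u m) (initialSet (u * Equiv.swap i j) m) ≤ (j : ℕ) - i := by
      rw [← sum_range_ite_between i j]
      refine Finset.sum_le_sum fun m _ => depth_le_iff.2 fun r _ => ?_
      have := hexc m r
      rw [excess, this]
      split_ifs <;> simp
    rw [Fin.lt_def] at hij
    rw [tiltedLength, h]
    omega

theorem hasPath_zero {n : ℕ} (u : Equiv.Perm (Fin n)) : HasPath u u 0 :=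
  ⟨fun _ => u, rfl, rfl, by simp⟩

theorem hasPath_succ {n : ℕ} {u v : Equiv.Perm (Fin n)} {m : ℕ} :
    HasPath u v (m + 1) ↔ ∃ x, (quantumBruhatGraph n).Adj u x ∧ HasPath x v m := by
  constructor
  · rintro ⟨p, rfl, rfl, h⟩
    exact ⟨p 1, h 0 (by omega), fun i => p (i + 1), rfl, rfl, fun i hi => h (i + 1) (by omega)⟩
  · rintro ⟨x, hx, p, rfl, rfl, h⟩
    refine ⟨fun i => Nat.casesOn i u p, rfl, rfl, fun i hi => ?_⟩
    cases i with
    | zero => exact hx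
    | succ i => exact h i (by omega)

theorem tiltedLength_le_of_hasPath {n m : ℕ} {u v : Equiv.Perm (Fin n)} (h : HasPath u v m) :
    tiltedLength u v ≤ m := by
  induction m generalizing u with
  | zero =>
    obtain ⟨p, rfl, rfl, -⟩ := h
    simp [tiltedLength_self]
  | succ m ih =>
    obtain ⟨x, hx, h⟩ := hasPath_succ.1 h
    have := tiltedLength_triangle u x v
    have := tiltedLength_le_one_of_adj hx
    have := ih h
    push_cast
    omega

/-- For a cut `r`, `Arc a b r` says that `r` lies in the half-open cyclic interval `(a, b]`. -/
def Arc (a b r : ℕ) : Prop := (a < r ∧ r ≤ b) ∨ (b < a ∧ (r ≤ b ∨ a < r))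

/-- If `u` and `v` agree before position `i` and no entry of `u[m]` from position `i` on lies in
`[r, s)`, then the excess does not drop from `r` to `s`, and it grows if `v i` lies in
`[r, s)`. -/
theorem excess_add_le {n : ℕ} {u v : Equiv.Perm (Fin n)} {i : Fin n} {m r s : ℕ} (hrs : r ≤ s)
    (him : (i : ℕ) < m) (hlt : ∀ p < i, u p = v p)
    (hge : ∀ p : Fin n, i ≤ p → (p : ℕ) < m → (u p : ℕ) < r ∨ s ≤ u p) :
    excess (initialSet u m) (initialSet v m) r + (if r ≤ v i ∧ (v i : ℕ) < s then 1 else 0) ≤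
      excess (initialSet u m) (initialSet v m) s := by
  have hsum : (if r ≤ v i ∧ (v i : ℕ) < s then 1 else 0 : ℤ) =
      ∑ p, if p = i then if r ≤ v i ∧ (v i : ℕ) < s then 1 else 0 else 0 := by simp
  simp only [excess, countBelow_initialSet]
  rw [hsum, ← Finset.sum_sub_distrib, ← Finset.sum_sub_distrib, ← Finset.sum_add_distrib]
  refine Finset.sum_le_sum fun p _ => ?_
  rcases lt_or_ge p i with hp | hp
  · rw [hlt p hp, if_neg hp.ne]
    simp
  · have := hge p hp
    by_cases hpi : p = i
    · subst hpi
      split_ifs <;> omega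
    · rw [if_neg hpi]
      split_ifs <;> omega

/-- If the entries of `u[m]` after the first difference `i` of `u` and `v` avoid the cyclic interval
`(u i, v i]`, then no cut in that interval realizes the depth. -/
theorem excess_lt_depth_of_arc {n : ℕ} {u v : Equiv.Perm (Fin n)} {i : Fin n} {m r : ℕ}
    (hr : r ≤ n) (him : (i : ℕ) < m) (hne : u i ≠ v i) (hlt : ∀ p < i, u p = v p)
    (hge : ∀ p : Fin n, i < p → (p : ℕ) < m → ¬ Arc (u i) (v i) (u p))
    (harc : Arc (u i) (v i) r) :
    excess (initialSet u m) (initialSet v m) r + 1 ≤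
      depth (initialSet u m) (initialSet v m) := by
  have hne' : (u i : ℕ) ≠ v i := fun h => hne (Fin.ext h)
  have hD := excess_le_depth (initialSet u m) (initialSet v m) (Nat.succ_le_of_lt (v i).2)
  rw [Nat.succ_eq_add_one] at hD
  by_cases hrv : r ≤ v i
  · have := excess_add_le (v := v) (r := r) (s := v i + 1) (by omega) him hlt fun p hp hpm => by
      rcases hp.eq_or_lt with rfl | hp
      · unfold Arc at harc; omega
      · have := hge p hp hpm; unfold Arc at this harc; omega
    rw [if_pos ⟨hrv, by omega⟩] at this
    omega
  · -- The interval wraps around, so the excess rises from `r` to `n` and then from `0` past `v i`.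
    have h1 := excess_add_le (v := v) (r := r) (s := n) hr him hlt fun p hp hpm => by
      rcases hp.eq_or_lt with rfl | hp
      · unfold Arc at harc; omega
      · have := hge p hp hpm; unfold Arc at this harc; omega
    have h2 := excess_add_le (v := v) (r := 0) (s := v i + 1) (by omega) him hlt fun p hp hpm => by
      rcases hp.eq_or_lt with rfl | hp
      · unfold Arc at harc; omega
      · have := hge p hp hpm; unfold Arc at this harc; omega
    rw [if_pos ⟨by omega, by omega⟩, excess_zero] at h2
    rw [excess_self (card_initialSet _ _ _)] at h1
    split_ifs at h1 <;> omega

/-- From `u ≠ v` there is an edge that brings `u` closer to `v`: exchange the first entry `u i`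
that differs from `v i` with the next entry in the cyclic interval `(u i, v i]`. -/
theorem exists_adj_tiltedLength_lt {n : ℕ} {u v : Equiv.Perm (Fin n)} (huv : u ≠ v) :
    ∃ x, (quantumBruhatGraph n).Adj u x ∧ tiltedLength x v + 1 ≤ tiltedLength u v := by
  obtain ⟨i, hi, hlt⟩ : ∃ i, u i ≠ v i ∧ ∀ p < i, u p = v p := by
    have hex : ∃ i, u i ≠ v i := by
      by_contra! h
      exact huv (Equiv.ext h)
    obtain ⟨i, hi, hmin⟩ := WellFounded.has_min (wellFounded_lt (α := Fin n)) {i | u i ≠ v i} hex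
    exact ⟨i, hi, fun p hp => by_contra fun h => hmin p h hp⟩
  obtain ⟨j, ⟨hij, hj⟩, hmin⟩ : ∃ j, (i < j ∧ Arc (u i) (v i) (u j)) ∧
      ∀ p, i < p → p < j → ¬ Arc (u i) (v i) (u p) := by
    have hne' : (u i : ℕ) ≠ v i := fun h => hi (Fin.ext h)
    have hex : ∃ j, i < j ∧ Arc (u i) (v i) (u j) := by
      refine ⟨u.symm (v i), ?_, ?_⟩
      · by_contra hle
        rcases (not_lt.1 hle).eq_or_lt with h | h
        · exact hi (by simpa using congrArg u h.symm)
        · have := hlt _ h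
          rw [Equiv.apply_symm_apply] at this
          exact h.ne' (v.injective this)
      · rw [Equiv.apply_symm_apply]
        unfold Arc
        omega
    obtain ⟨j, hj, hmin⟩ := WellFounded.has_min (wellFounded_lt (α := Fin n))
      {j | i < j ∧ Arc (u i) (v i) (u j)} hex
    exact ⟨j, hj, fun p h1 h2 h3 => hmin p ⟨h1, h3⟩ h2⟩
  have hkey : ∀ m r : ℕ, r ≤ n → (i : ℕ) < m → m ≤ j → Arc (u i) (v i) r →
      excess (initialSet u m) (initialSet v m) r + 1 ≤
        depth (initialSet u m) (initialSet v m) := fun m r hr him hmj harc =>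
    excess_lt_depth_of_arc hr him hi hlt
      (fun p hp hpm => hmin p hp (by rw [Fin.lt_def]; omega)) harc
  have hexc (m r : ℕ) : excess (initialSet (u * Equiv.swap i j) m) (initialSet v m) r =
      excess (initialSet u m) (initialSet v m) r - if (i : ℕ) < m ∧ m ≤ j then
        (if (u j : ℕ) < r then 1 else 0) - (if (u i : ℕ) < r then 1 else 0) else 0 := by
    rw [excess, countBelow_initialSet_mul_swap u hij m r, excess]
    ring
  have hij' : (i : ℕ) < j := hij
  refine ⟨u * Equiv.swap i j, ?_⟩
  rcases lt_or_gt_of_ne (u.injective.ne hij.ne) with huij | huij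
  · -- An ordinary Bruhat cover, which does not change the depths.
    have hl : (coxeterLength (u * Equiv.swap i j) : ℤ) = coxeterLength u + 1 := by
      have := card_inversions_mul_swap u hij huij
      rw [Finset.filter_false_of_mem, Finset.card_empty] at this
      · rw [coxeterLength_eq_card_inversions, coxeterLength_eq_card_inversions]
        omega
      · intro m hm hc
        rw [Finset.mem_Ioo] at hm
        have := hmin m hm.1 hm.2
        unfold Arc at this hj
        simp only [Fin.lt_def] at hc huij
        omega
    have hD : ∑ m ∈ Finset.range n, depth (initialSet (u * Equiv.swap i j) m) (initialSet v m) ≤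
        ∑ m ∈ Finset.range n, depth (initialSet u m) (initialSet v m) := by
      refine Finset.sum_le_sum fun m _ => depth_le_iff.2 fun r hr => ?_
      have h1 := hkey m r hr
      have h2 := excess_le_depth (initialSet u m) (initialSet v m) hr
      rw [Fin.lt_def] at huij
      unfold Arc at h1 hj
      rw [hexc]
      split_ifs <;> omega
    refine ⟨⟨i, j, hij, rfl, Or.inl hl⟩, ?_⟩
    simp only [tiltedLength]
    omega
  · -- A quantum edge, which lowers by one each depth with `i < m ≤ j`.
    have hl : (coxeterLength (u * Equiv.swap i j) : ℤ) =
        coxeterLength u + 1 - 2 * (((j : ℕ) : ℤ) - ((i : ℕ) : ℤ)) := by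
      have := card_inversions_mul_swap (u * Equiv.swap i j) hij (by simpa using huij)
      rw [mul_swap_mul_swap, Finset.filter_true_of_mem, Fin.card_Ioo] at this
      · rw [coxeterLength_eq_card_inversions, coxeterLength_eq_card_inversions]
        omega
      · intro m hm
        rw [Finset.mem_Ioo] at hm
        have := hmin m hm.1 hm.2
        have hmi : (u m : ℕ) ≠ u i := fun h => hm.1.ne' (u.injective (Fin.ext h))
        rw [Equiv.Perm.mul_apply, Equiv.Perm.mul_apply, Equiv.Perm.mul_apply,
          Equiv.swap_apply_left, Equiv.swap_apply_right,
          Equiv.swap_apply_of_ne_of_ne hm.1.ne' hm.2.ne]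
        unfold Arc at this hj
        simp only [Fin.lt_def] at huij ⊢
        omega
    have hD : ∑ m ∈ Finset.range n, depth (initialSet (u * Equiv.swap i j) m) (initialSet v m) +
        ((j : ℕ) - i) ≤ ∑ m ∈ Finset.range n, depth (initialSet u m) (initialSet v m) := by
      rw [← sum_range_ite_between i j, ← Finset.sum_add_distrib]
      refine Finset.sum_le_sum fun m _ => ?_
      rw [Fin.lt_def] at huij
      unfold Arc at hkey hj
      by_cases hm : (i : ℕ) < m ∧ m ≤ j
      · rw [if_pos hm]
        have h0 := hkey m 0 (Nat.zero_le _) hm.1 hm.2 (by omega)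
        rw [excess_zero] at h0
        refine Nat.add_le_of_le_sub (by omega) (depth_le_iff.2 fun r hr => ?_)
        have h1 := hkey m r hr hm.1 hm.2
        have h2 := excess_le_depth (initialSet u m) (initialSet v m) hr
        rw [hexc, if_pos hm]
        split_ifs <;> omega
      · rw [if_neg hm, add_zero]
        refine depth_le_iff.2 fun r hr => ?_
        rw [hexc, if_neg hm, sub_zero]
        exact excess_le_depth _ _ hr
    refine ⟨⟨i, j, hij, rfl, Or.inr hl⟩, ?_⟩
    simp only [tiltedLength]
    omega

/-- Following the edges of `exists_adj_tiltedLength_lt` until `v` is reached gives a path of length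
at most `tiltedLength u v`. -/
theorem exists_hasPath_le_tiltedLength {n : ℕ} (u v : Equiv.Perm (Fin n)) :
    ∃ m : ℕ, HasPath u v m ∧ (m : ℤ) ≤ tiltedLength u v := by
  -- `tiltedLength` is bounded below because there are finitely many permutations.
  obtain ⟨c, hc⟩ := Finite.exists_min fun x : Equiv.Perm (Fin n) => tiltedLength x v
  induction hN : (tiltedLength u v - tiltedLength c v).toNat using Nat.strong_induction_on
    generalizing u with
  | _ N ih =>
    by_cases huv : u = v
    · subst huv
      exact ⟨0, hasPath_zero u, by simp [tiltedLength_self]⟩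
    · obtain ⟨x, hx, hlt⟩ := exists_adj_tiltedLength_lt huv
      have := hc x
      obtain ⟨m, hm, hle⟩ := ih _ (by omega) x rfl
      exact ⟨m + 1, hasPath_succ.2 ⟨x, hx, hm⟩, by push_cast; omega⟩

theorem pathDist_eq_tiltedLength {n : ℕ} (u v : Equiv.Perm (Fin n)) :
    (pathDist u v : ℤ) = tiltedLength u v := by
  obtain ⟨m, hm, hle⟩ := exists_hasPath_le_tiltedLength u v
  have h1 : pathDist u v ≤ m := Nat.sInf_le hm
  have h2 := tiltedLength_le_of_hasPath (Nat.sInf_mem (⟨m, hm⟩ : Set.Nonempty {m | HasPath u v m}))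
  exact le_antisymm (by omega) h2

/-! ### The tilted Bruhat order -/

/-- `w ≤_u v` says that the triangle inequality for `tiltedLength` is an equality. The Coxeter
lengths cancel, and a sum of triangle inequalities is an equality only if each of them is. -/
theorem tiltedLE_iff_depth {n : ℕ} (u w v : Equiv.Perm (Fin n)) :
    TiltedLE u w v ↔ ∀ m < n, depth (initialSet u m) (initialSet w m) +
      depth (initialSet w m) (initialSet v m) = depth (initialSet u m) (initialSet v m) := by
  have h1 := pathDist_eq_tiltedLength u w
  have h2 := pathDist_eq_tiltedLength w v
  have h3 := pathDist_eq_tiltedLength u v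
  have h4 := Finset.sum_eq_sum_iff_of_le (s := Finset.range n) fun m _ =>
    depth_triangle (initialSet u m) (initialSet w m) (initialSet v m)
  rw [Finset.sum_add_distrib] at h4
  simp only [Finset.mem_range, eq_comm (a := depth (initialSet u _) (initialSet v _))] at h4
  rw [← h4, TiltedLE]
  simp only [tiltedLength] at h1 h2 h3
  omega

theorem tiltedLE_self {n : ℕ} (u x : Equiv.Perm (Fin n)) : TiltedLE u u x :=
  (tiltedLE_iff_depth u u x).2 fun m _ => by rw [depth_self, zero_add]

/-- A common shift for two Gale comparisons is a cut that realizes both depths, so at that cut the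
excesses add up to the sum of the depths. -/
theorem depth_add_depth_eq_of_galeLE {n : ℕ} {A B C : Finset (Fin n)} {r : Fin n}
    (h1 : GaleLE r A B) (h2 : GaleLE r B C) : depth A B + depth B C = depth A C := by
  refine le_antisymm ?_ (depth_triangle A B C)
  have e1 := (galeLE_iff_excess_eq_depth r h1.card_eq).1 h1
  have e2 := (galeLE_iff_excess_eq_depth r h2.card_eq).1 h2
  have e3 := excess_le_depth A C r.2.le
  have e4 := excess_add A B C r
  omega

/-- If the triangle inequality for depths is an equality, a cut that realizes the depth of `A, C`
leaves no slack in either summand. -/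
theorem galeLE_and_galeLE_of_depth_add_depth_eq {n : ℕ} {A B C : Finset (Fin n)} {r : Fin n}
    (hAB : A.card = B.card) (hBC : B.card = C.card) (h : depth A B + depth B C = depth A C)
    (hr : GaleLE r A C) : GaleLE r A B ∧ GaleLE r B C := by
  rw [galeLE_iff_excess_eq_depth r (hAB.trans hBC)] at hr
  rw [galeLE_iff_excess_eq_depth r hAB, galeLE_iff_excess_eq_depth r hBC]
  have e1 := excess_le_depth A B r.2.le
  have e2 := excess_le_depth B C r.2.le
  have e4 := excess_add A B C r
  omega

theorem exists_galeLE {n : ℕ} [NeZero n] {A B : Finset (Fin n)} (h : A.card = B.card) :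
    ∃ r, GaleLE r A B := by
  simpa only [galeLE_iff_excess_eq_depth _ h] using exists_excess_eq_depth h

end TiltedBruhat

open TiltedBruhat
theorem theorem3p7 (n : ℕ) (u v w : Equiv.Perm (Fin n)) :
    List.TFAE [
      TiltedLE u w v,
      w ∈ tiltedInterval u v,
      ∀ a : Fin (n - 1) → Fin n,
        (∀ k : Fin (n - 1), GaleLE (a k) (initialSet u (k + 1)) (initialSet v (k + 1))) →
        ∀ k : Fin (n - 1),
          GaleLE (a k) (initialSet u (k + 1)) (initialSet w (k + 1)) ∧
          GaleLE (a k) (initialSet w (k + 1)) (initialSet v (k + 1)),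
      ∃ a : Fin (n - 1) → Fin n, ∀ k : Fin (n - 1),
        GaleLE (a k) (initialSet u (k + 1)) (initialSet w (k + 1)) ∧
        GaleLE (a k) (initialSet w (k + 1)) (initialSet v (k + 1))] := by
  tfae_have 1 ↔ 2 := ⟨fun h => ⟨tiltedLE_self u w, h⟩, fun h => h.2⟩
  tfae_have 1 → 3 := by
    intro h a ha k
    exact galeLE_and_galeLE_of_depth_add_depth_eq (card_initialSet _ _ _) (card_initialSet _ _ _)
      ((tiltedLE_iff_depth u w v).1 h _ (by omega)) (ha k)
  tfae_have 3 → 4 := by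
    intro h
    have hex : ∀ k : Fin (n - 1), ∃ r : Fin n,
        GaleLE r (initialSet u (k + 1)) (initialSet v (k + 1)) := fun k =>
      have : NeZero n := ⟨by have := k.2; omega⟩
      exists_galeLE (card_initialSet _ _ _)
    choose a ha using hex
    exact ⟨a, h a ha⟩
  tfae_have 4 → 1 := by
    rintro ⟨a, ha⟩
    refine (tiltedLE_iff_depth u w v).2 fun m hm => ?_
    rcases m with _ | k
    · simp [initialSet, depth_self]
    · have := ha ⟨k, by omega⟩
      exact depth_add_depth_eq_of_galeLE this.1 this.2
  tfae_finish
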